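/- Let $(A,<)$ be an infinite linearly ordered set, let $m<\omega$, and let $(A^{\underline m})_<$ be the set of strictly increasing $m$-tuples of elements of $A$. For $\bar a,\bar b\in(A^{\underline m})_<$ put $f_{\bar a,\bar b}=\{(i,j)\in m\times m : a_i=b_j\}$. Let $G=((A^{\underline m})_<,E)$ be a graph (that is, $E$ is symmetric and irreflexive) whose chromatic number satisfies $\chi(G)\ge\aleph_0$, and assume that for all $\bar a,\bar b,\bar c,\bar d\in(A^{\underline m})_<$, if $\bar a\mathrel{E}\bar b$ and $f_{\bar a,\bar b}=f_{\bar c,\bar d}$, then $\bar c\mathrel{E}\bar d$. Then there exists a natural number $n\ge 1$ such that $G$ contains all finite subgraphs of the shift graph $\mathrm{Sh}_n(\omega)$, i.e. every finite subgraph of $\mathrm{Sh}_n(\omega)$ admits an injective graph homomorphism into $G$. Here $\mathrm{Sh}_n(\omega)$ is the graph whose vertices are the strictly increasing $n$-tuples of natural numbers, where distinct $s,t$ are joined by an edge if $s(i)=t(i-1)$ for every $1\le i\le n-1$, or $t(i)=s(i-1)$ for every $1\le i\le n-1$ (so $\mathrm{Sh}_1(\omega)$ is the complete graph on $\omega$).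 -/

import Mathlib

universe u

/-- The chromatic number of a graph, as a cardinal: the least cardinality of a set of colours that
admits a proper vertex colouring. (Colour sets may be taken in the universe of the vertices, since
a graph is always properly coloured by its own vertex set.) -/
noncomputable def cardChromaticNumber {V : Type u} (G : SimpleGraph V) : Cardinal.{u} :=
  sInf {κ : Cardinal.{u} | ∃ C : Type u, Cardinal.mk C = κ ∧ Nonempty (G.Coloring C)}

/-- Strictly increasing `m`-tuples of elements of a linear order `A`. -/
abbrev IncTuple (m : ℕ) (A : Type u) [LinearOrder A] : Type u := Fin m ↪o A

/-- The equality pattern `f_{a,b} = {(i, j) : a_i = b_j}` of two tuples. -/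
def eqPattern {A : Type u} [LinearOrder A] {m : ℕ} (a b : IncTuple m A) : Set (Fin m × Fin m) :=
  {p | a p.1 = b p.2}

/-- The shift graph `Sh_r(A)` on the increasing `r`-tuples of `A`: distinct `s` and `t` are joined
if `s(i) = t(i-1)` for all `1 ≤ i ≤ r - 1`, or vice versa. Distinctness is automatic for `2 ≤ r`;
for `r = 1` the graph is the complete graph. -/
def shiftGraph (r : ℕ) (A : Type u) [LinearOrder A] : SimpleGraph (IncTuple r A) :=
  SimpleGraph.fromRel fun s t =>
    ∀ (i : ℕ) (h : i + 1 < r), s ⟨i + 1, h⟩ = t ⟨i, Nat.lt_of_succ_lt h⟩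

/-- `G` contains all finite subgraphs of `H`: each of them embeds in `G` by an injective graph
homomorphism (not necessarily as an induced subgraph). -/
def ContainsFiniteSubgraphs {V W : Type*} (G : SimpleGraph V) (H : SimpleGraph W) : Prop :=
  ∀ K : H.Subgraph, K.verts.Finite → K.coe.IsContained G

/-! An edge `a E b` exists, and its pattern `F` is an order-preserving partial injection of indices.
It suffices to send `n`-tuples injectively to `m`-tuples so that a shift yields exactly the pattern
`F`. Cut the indices into blocks that no arc of `F` leaves. A fixed point is alone in its block;
elsewhere `F` only goes up or only goes down within a block (`blockStart_ne`). By `exists_height`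
the arcs become the pairs at distance one on the rational line; integer and fractional parts of the
heights give levels and offsets. Let `n` be one more than the largest level of a non-fixed point.
Coordinate `i` is the lexicographic triple of its block, a signed entry of the `n`-tuple selected by
its level, and its offset. Only finitely many triples occur, so they embed in `A`. -/

/-- The partial relation `F` preserves and reflects the order in both coordinates. -/
def OrderPreservingRel (F : ℕ → ℕ → Prop) : Prop :=
  ∀ ⦃i j i' j' : ℕ⦄, F i j → F i' j' → (i < i' ↔ j < j')

/-- `F` relates the two distinct points `i < j`, in one direction or the other. -/
def Arc (F : ℕ → ℕ → Prop) (i j : ℕ) : Prop := i < j ∧ (F i j ∨ F j i)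

/-- No arc of `F` passes from below `k` to `k` or beyond. -/
def IsCut (F : ℕ → ℕ → Prop) (k : ℕ) : Prop := ∀ i j, Arc F i j → ¬ (i < k ∧ k ≤ j)

open Classical in
/-- The last cut of `F` at or before `i`; its fibres are the blocks of `F`. -/
noncomputable def blockStart (F : ℕ → ℕ → Prop) (i : ℕ) : ℕ := Nat.findGreatest (IsCut F) i

/-- For arcs of equal direction this is the hypothesis; arcs of opposite direction span disjoint
intervals. -/
theorem OrderPreservingRel.arc_lt_iff {F : ℕ → ℕ → Prop} (hF : OrderPreservingRel F)
    {i j i' j' : ℕ} (h : Arc F i j) (h' : Arc F i' j') : i < i' ↔ j < j' := by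
  obtain ⟨hij, h | h⟩ := h <;> obtain ⟨hij', h' | h'⟩ := h' <;> have := hF h h' <;> omega

/-- An upward and a downward arc span disjoint intervals. -/
theorem OrderPreservingRel.disjoint_arcs {F : ℕ → ℕ → Prop} (hF : OrderPreservingRel F)
    {i j i' j' : ℕ} (hij : i < j) (h : F i j) (hij' : i' < j') (h' : F j' i') :
    j < i' ∨ j' < i := by
  have h1 := hF h h'
  have h2 := hF h' h
  omega

/-- Heights that turn the arcs of `F` into the pairs of points at distance one. -/
theorem OrderPreservingRel.exists_height {F : ℕ → ℕ → Prop} (hF : OrderPreservingRel F) (m : ℕ) :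
    ∃ y : ℕ → ℚ, (∀ i j, i < j → j < m → y i < y j) ∧
      ∀ i j, i < m → j < m → (Arc F i j ↔ y j = y i + 1) := by
  classical
  -- Points are placed from left to right. The third clause keeps `y i + 1` free above all earlier
  -- points until the upper end of an arc from `i` is reached.
  suffices H : ∀ k, ∃ y : ℕ → ℚ, (∀ i j, i < j → j < k → y i < y j) ∧
      (∀ i j, i < k → j < k → (Arc F i j ↔ y j = y i + 1)) ∧
      ∀ i j l, i < k → l < k → Arc F i j → l < j → y l < y i + 1 by
    obtain ⟨y, h1, h2, -⟩ := H m
    exact ⟨y, h1, h2⟩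
  intro k
  induction k with
  | zero => exact ⟨0, by simp, by simp, by simp⟩
  | succ k ih =>
    obtain ⟨y, hlt, harc, hbd⟩ := ih
    obtain ⟨v, hv1, hv2, hv3⟩ : ∃ v : ℚ, (∀ l < k, y l < v) ∧
        (∀ i < k, Arc F i k ↔ v = y i + 1) ∧
        ∀ i j, i < k → Arc F i j → k < j → v < y i + 1 := by
      by_cases hk : ∃ i, Arc F i k
      · obtain ⟨i₀, h₀⟩ := hk
        have hi₀ : i₀ < k := h₀.1
        refine ⟨y i₀ + 1, fun l hl => hbd i₀ k l hi₀ hl h₀ hl, fun i hi => ⟨fun h => ?_, fun h => ?_⟩,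
          fun i j hi h hkj => ?_⟩
        · have h1 := hF.arc_lt_iff h h₀
          have h2 := hF.arc_lt_iff h₀ h
          have : i = i₀ := by omega
          rw [this]
        · have he : y i₀ = y i := by linarith
          rcases lt_trichotomy i i₀ with h' | h' | h'
          · exact absurd he (hlt _ _ h' hi₀).ne'
          · exact h' ▸ h₀
          · exact absurd he (hlt _ _ h' hi).ne
        · have := hlt i₀ i ((hF.arc_lt_iff h₀ h).2 hkj) hi
          linarith
      · push Not at hk
        -- With no arc ending at `k`, the new height goes above all old ones and below every `y i +
        -- 1` that exceeds them all, so it equals no `y i + 1`.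
        obtain ⟨v, hv1, hv2⟩ := Order.exists_between_finsets
          (lo := (Finset.range k).image y)
          (hi := ((Finset.range k).filter fun i => ∀ l < k, y l < y i + 1).image fun i => y i + 1)
          (by
            intro x hx z hz
            simp only [Finset.mem_image, Finset.mem_range, Finset.mem_filter] at hx hz
            obtain ⟨l, hl, rfl⟩ := hx
            obtain ⟨i, ⟨-, hi⟩, rfl⟩ := hz
            exact hi l hl)
        have hlow : ∀ l < k, y l < v := fun l hl =>
          hv1 _ (Finset.mem_image_of_mem _ (Finset.mem_range.2 hl))
        have hup : ∀ i < k, (∀ l < k, y l < y i + 1) → v < y i + 1 := fun i hi h =>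
          hv2 _ (Finset.mem_image_of_mem (fun i => y i + 1)
            (Finset.mem_filter.2 ⟨Finset.mem_range.2 hi, h⟩))
        refine ⟨v, hlow, fun i hi => ⟨fun h => absurd h (hk i), fun h => ?_⟩,
          fun i j hi h hkj => hup i hi fun l hl => hbd i j l hi hl h (hl.trans hkj)⟩
        exact absurd h (hup i hi fun l hl => h ▸ hlow l hl).ne
    have hne : ∀ i, i < k → Function.update y k v i = y i := fun i hi =>
      Function.update_of_ne hi.ne _ _
    refine ⟨Function.update y k v, fun i j hij hj => ?_, fun i j hi hj => ?_,
      fun i j l hi hl h hlj => ?_⟩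
    · rcases Nat.lt_succ_iff_lt_or_eq.1 hj with hj | rfl
      · rw [hne i (hij.trans hj), hne j hj]
        exact hlt i j hij hj
      · rw [hne i hij, Function.update_self]
        exact hv1 i hij
    · rcases Nat.lt_succ_iff_lt_or_eq.1 hi with hi | rfl <;>
        rcases Nat.lt_succ_iff_lt_or_eq.1 hj with hj | rfl
      · rw [hne i hi, hne j hj]
        exact harc i j hi hj
      · rw [hne i hi, Function.update_self]
        exact hv2 i hi
      · rw [hne j hj, Function.update_self]
        refine ⟨fun h => absurd h.1 (by omega), fun h => ?_⟩
        have := hv1 j hj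
        linarith
      · exact ⟨fun h => absurd h.1 (by omega), fun h => by linarith⟩
    · rcases Nat.lt_succ_iff_lt_or_eq.1 hi with hi | rfl <;>
        rcases Nat.lt_succ_iff_lt_or_eq.1 hl with hl | rfl
      · rw [hne i hi, hne l hl]
        exact hbd i j l hi hl h hlj
      · rw [hne i hi, Function.update_self]
        exact hv3 i j hi h hlj
      · rw [hne l hl, Function.update_self]
        have := hv1 l hl
        linarith
      · linarith

/-! ### Blocks between consecutive cuts -/

section Blocks

variable {F : ℕ → ℕ → Prop}

theorem isCut_blockStart (i : ℕ) : IsCut F (blockStart F i) := by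
  classical
  exact Nat.findGreatest_spec (P := IsCut F) (Nat.zero_le i) fun i j _ h => by omega

theorem blockStart_le (i : ℕ) : blockStart F i ≤ i := by
  classical
  exact Nat.findGreatest_le i

theorem IsCut.le_blockStart {k i : ℕ} (h : IsCut F k) (hk : k ≤ i) : k ≤ blockStart F i := by
  classical
  exact Nat.le_findGreatest hk h

theorem blockStart_mono {i j : ℕ} (h : i ≤ j) : blockStart F i ≤ blockStart F j :=
  (isCut_blockStart i).le_blockStart ((blockStart_le i).trans h)

theorem not_isCut_of_blockStart_eq {i k j : ℕ} (h : blockStart F i = blockStart F j)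
    (hik : i < k) (hkj : k ≤ j) : ¬ IsCut F k := fun hk => by
  have h1 := hk.le_blockStart hkj
  have h2 := blockStart_le (F := F) i
  omega

theorem Arc.blockStart_eq {i j : ℕ} (h : Arc F i j) : blockStart F i = blockStart F j := by
  refine le_antisymm (blockStart_mono h.1.le) ((isCut_blockStart j).le_blockStart ?_)
  by_contra hlt
  exact isCut_blockStart j i j h ⟨by omega, blockStart_le j⟩

theorem blockStart_eq_of_rel {i j : ℕ} (h : F i j) : blockStart F i = blockStart F j := by
  rcases lt_trichotomy i j with hij | rfl | hij
  · exact Arc.blockStart_eq ⟨hij, Or.inl h⟩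
  · rfl
  · exact (Arc.blockStart_eq ⟨hij, Or.inr h⟩).symm

/-- A fixed point is alone in its block. -/
theorem OrderPreservingRel.eq_of_fixed (hF : OrderPreservingRel F) {i j : ℕ} (hi : F i i)
    (h : blockStart F i = blockStart F j) : i = j := by
  rcases lt_trichotomy i j with hij | hij | hij
  -- Both ends of an arc lie strictly on the same side of the fixed point `i`, so `i` and `i + 1`
  -- are cuts.
  · refine absurd ?_ (not_isCut_of_blockStart_eq h (Nat.lt_succ_self i) hij)
    rintro a b ⟨hab, hr | hr⟩ <;> have h1 := hF hi hr <;> have h2 := hF hr hi <;> omega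
  · exact hij
  · refine absurd ?_ (not_isCut_of_blockStart_eq h.symm hij le_rfl)
    rintro a b ⟨hab, hr | hr⟩ <;> have h1 := hF hi hr <;> have h2 := hF hr hi <;> omega

theorem exists_arc_of_not_isCut {k : ℕ} (h : ¬ IsCut F k) : ∃ i j, Arc F i j ∧ i < k ∧ k ≤ j := by
  simp only [IsCut, not_forall, not_not] at h
  obtain ⟨i, j, h1, h2⟩ := h
  exact ⟨i, j, h1, h2⟩

/-- A property of arcs that spreads to overlapping arcs spreads to all arcs of the same block. -/
theorem arc_induction {P : ℕ → ℕ → Prop}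
    (hP : ∀ {i j i' j'}, Arc F i j → Arc F i' j' → i ≤ j' → i' ≤ j → P i j → P i' j')
    {i j i' j' : ℕ} (h : Arc F i j) (h' : Arc F i' j')
    (hb : blockStart F i = blockStart F i') (hp : P i j) : P i' j' := by
  rcases le_total i i' with hle | hle
  -- Sweep `k` to the right: arcs crossing `k` and `k + 1` overlap, so `P` passes from one to the
  -- next.
  · have key : ∀ k, i < k → k ≤ j' → ∃ a b, Arc F a b ∧ a < k ∧ k ≤ b ∧ P a b := by
      intro k hik
      induction k, hik using Nat.le_induction with
      | base => exact fun _ => ⟨i, j, h, Nat.lt_succ_self i, h.1, hp⟩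
      | succ k hik ih =>
        intro hk
        obtain ⟨a, b, hab, h1, h2, h3⟩ := ih (by omega)
        obtain ⟨c, d, hcd, h4, h5⟩ := exists_arc_of_not_isCut
          (not_isCut_of_blockStart_eq (k := k + 1) (hb.trans h'.blockStart_eq) (by omega) hk)
        exact ⟨c, d, hcd, h4, h5, hP hab hcd (by omega) (by omega) h3⟩
    obtain ⟨a, b, hab, h1, h2, h3⟩ := key j' (hle.trans_lt h'.1) le_rfl
    exact hP hab h' h1.le (h'.1.le.trans h2) h3
  · have key : ∀ d k, k + d = j → i' < k → ∃ a b, Arc F a b ∧ a < k ∧ k ≤ b ∧ P a b := by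
      intro d
      induction d with
      | zero => exact fun k hk _ => ⟨i, j, h, by have := h.1; omega, by omega, hp⟩
      | succ d ih =>
        intro k hk hik
        obtain ⟨a, b, hab, h1, h2, h3⟩ := ih (k + 1) (by omega) (by omega)
        obtain ⟨c, e, hce, h4, h5⟩ := exists_arc_of_not_isCut
          (not_isCut_of_blockStart_eq (k := k) (hb.symm.trans h.blockStart_eq) hik (by omega))
        exact ⟨c, e, hce, h4, h5, hP hab hce (by omega) (by omega) h3⟩
    have h1 := h.1
    obtain ⟨a, b, hab, h1, h2, h3⟩ := key (j - (i' + 1)) (i' + 1) (by omega) (by omega)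
    exact hP hab h' (by have := h'.1; omega) (by omega) h3

/-- Upward and downward arcs do not share a block. -/
theorem OrderPreservingRel.blockStart_ne (hF : OrderPreservingRel F) {i j i' j' : ℕ}
    (hij : i < j) (h : F i j) (hij' : i' < j') (h' : F j' i') :
    blockStart F i ≠ blockStart F i' := fun hb => by
  have hup : F i' j' := by
    refine arc_induction (P := F) ?_ ⟨hij, Or.inl h⟩ ⟨hij', Or.inr h'⟩ hb h
    rintro a b c d hab ⟨hcd, hr | hr⟩ h1 h2 h3
    · exact hr
    · have := hF.disjoint_arcs hab.1 h3 hcd hr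
      omega
  have := hF hup h'
  omega

end Blocks

/-! ### Levels and offsets -/

/-- Integer levels and rational offsets for the points below `m`, organised in blocks on each of
which `F` is either the upward or the downward shift by one level. -/
structure PatternCoding (F : ℕ → ℕ → Prop) (m : ℕ) where
  block : ℕ → ℕ
  up : ℕ → Prop
  level : ℕ → ℕ
  offset : ℕ → ℚ
  block_mono : ∀ {i j}, i ≤ j → block i ≤ block j
  eq_of_fixed : ∀ {i j}, F i i → block i = block j → i = j
  level_lt : ∀ {i j}, i < j → j < m → block i = block j →
    level i < level j ∨ level i = level j ∧ offset i < offset j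
  rel_up : ∀ {i j}, i < m → j < m → ¬ F i i → up (block i) →
    (F i j ↔ block i = block j ∧ level j = level i + 1 ∧ offset j = offset i)
  rel_down : ∀ {i j}, i < m → j < m → ¬ F i i → ¬ up (block i) →
    (F i j ↔ block i = block j ∧ level i = level j + 1 ∧ offset j = offset i)
  exists_level : ∀ {i}, i < m → ∀ k ≤ level i, ∃ j < m, block j = block i ∧ level j = k

theorem OrderPreservingRel.nonempty_patternCoding {F : ℕ → ℕ → Prop} (hF : OrderPreservingRel F)
    (m : ℕ) (hm : ∀ i j, F i j → i < m ∧ j < m) : Nonempty (PatternCoding F m) := by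
  obtain ⟨y, hlt, harc⟩ := hF.exists_height m
  have hle : ∀ i j, i ≤ j → j < m → y i ≤ y j := fun i j hij hj => by
    rcases hij.eq_or_lt with rfl | h
    · exact le_rfl
    · exact (hlt i j h hj).le
  let level : ℕ → ℕ := fun i => (⌊y i⌋ - ⌊y (blockStart F i)⌋).toNat
  have hlevel : ∀ i < m, (level i : ℤ) = ⌊y i⌋ - ⌊y (blockStart F i)⌋ := fun i hi =>
    Int.toNat_of_nonneg (sub_nonneg.2 (Int.floor_le_floor (hle _ _ (blockStart_le i) hi)))
  have hcode : ∀ i j, i < m → j < m → (Arc F i j ↔ blockStart F i = blockStart F j ∧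
      level j = level i + 1 ∧ Int.fract (y j) = Int.fract (y i)) := by
    intro i j hi hj
    have h1 := hlevel i hi
    have h2 := hlevel j hj
    constructor
    · intro h
      have hb := h.blockStart_eq
      have hy := (harc i j hi hj).1 h
      rw [← hb, hy, Int.floor_add_one] at h2
      exact ⟨hb, by omega, by rw [hy, Int.fract_add_one]⟩
    · rintro ⟨hb, hl, hf⟩
      rw [harc i j hi hj]
      rw [hb] at h1
      have h3 : ⌊y j⌋ = ⌊y i⌋ + 1 := by omega
      have h4 := Int.floor_add_fract (y j)
      have h5 := Int.floor_add_fract (y i)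
      rw [h3, hf] at h4
      push_cast at h4
      linarith
  refine ⟨{
    block := blockStart F
    -- A block without arcs counts as downward.
    up := fun b => ∃ i j, F i j ∧ i < j ∧ blockStart F i = b
    level := level
    offset := fun i => Int.fract (y i)
    block_mono := blockStart_mono
    eq_of_fixed := fun h h' => hF.eq_of_fixed h h'
    level_lt := ?_
    rel_up := ?_
    rel_down := ?_
    exists_level := ?_ }⟩
  · intro i j hij hj hb
    have h1 := hlevel i (hij.trans hj)
    have h2 := hlevel j hj
    rw [← hb] at h2
    have hy := hlt i j hij hj
    have hfl := Int.floor_le_floor hy.le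
    rcases hfl.eq_or_lt with h | h
    · refine Or.inr ⟨by omega, ?_⟩
      have h4 := Int.floor_add_fract (y j)
      have h5 := Int.floor_add_fract (y i)
      rw [h] at h5
      linarith
    · exact Or.inl (by omega)
  · rintro i j hi hj hfix ⟨a, b, hab, hlt', hba⟩
    rw [← hcode i j hi hj]
    constructor
    · intro h
      rcases lt_trichotomy i j with hij | rfl | hij
      · exact ⟨hij, Or.inl h⟩
      · exact absurd h hfix
      · exact absurd (hba.trans (blockStart_eq_of_rel h)) (hF.blockStart_ne hlt' hab hij h)
    · rintro ⟨hij, h | h⟩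
      · exact h
      · exact absurd hba (hF.blockStart_ne hlt' hab hij h)
  · intro i j hi hj hfix hup
    have : F i j ↔ Arc F j i := by
      constructor
      · intro h
        rcases lt_trichotomy i j with hij | rfl | hij
        · exact absurd ⟨i, j, h, hij, rfl⟩ hup
        · exact absurd h hfix
        · exact ⟨hij, Or.inr h⟩
      · rintro ⟨hij, h | h⟩
        · exact absurd ⟨j, i, h, hij, blockStart_eq_of_rel h⟩ hup
        · exact h
    rw [this, hcode j i hj hi]
    exact ⟨fun h => ⟨h.1.symm, h.2.1, h.2.2.symm⟩, fun h => ⟨h.1.symm, h.2.1, h.2.2.symm⟩⟩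
  · intro i
    induction i with
    | zero =>
      intro hi k hk
      have h0 : level 0 = 0 := by
        have h1 := hlevel 0 hi
        rw [Nat.le_zero.1 (blockStart_le (F := F) 0)] at h1
        omega
      exact ⟨0, hi, rfl, by omega⟩
    | succ i ih =>
      intro hi k hk
      rcases hk.eq_or_lt with rfl | hk
      · exact ⟨i + 1, hi, rfl, rfl⟩
      have h1 := hlevel (i + 1) hi
      by_cases hc : IsCut F (i + 1)
      · have h2 : blockStart F (i + 1) = i + 1 :=
          le_antisymm (blockStart_le _) (hc.le_blockStart le_rfl)
        rw [h2] at h1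
        omega
      · have hb : blockStart F i = blockStart F (i + 1) := by
          refine le_antisymm (blockStart_mono (Nat.le_succ i))
            ((isCut_blockStart (i + 1)).le_blockStart ?_)
          have h3 := blockStart_le (F := F) (i + 1)
          have h4 : blockStart F (i + 1) ≠ i + 1 := fun h => hc (h ▸ isCut_blockStart (i + 1))
          omega
        obtain ⟨a, b, hab, ha, hb'⟩ := exists_arc_of_not_isCut hc
        have hbm : b < m := by
          obtain ⟨-, h | h⟩ := hab
          · exact (hm _ _ h).2
          · exact (hm _ _ h).1
        have hy := (harc a b (by omega) hbm).1 hab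
        have h3 := hle (i + 1) b hb' hbm
        have h4 := hle a i (by omega) (by omega)
        -- An arc of height one spans `i` and `i + 1`, so levels in a block skip no value.
        have h5 : ⌊y (i + 1)⌋ ≤ ⌊y i⌋ + 1 := by
          rw [← Int.floor_add_one]
          exact Int.floor_le_floor (by linarith)
        have h6 := hlevel i (by omega)
        rw [hb] at h6
        obtain ⟨j, hj, hj1, hj2⟩ := ih (by omega) k (by omega)
        exact ⟨j, hj, hj1.trans hb, hj2⟩

/-! ### From `n`-tuples to `m`-tuples -/

/-- `t` is the tuple `s` with the first entry dropped and a new last entry appended. -/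
def IsShift {n : ℕ} (s t : Fin n ↪o ℕ) : Prop :=
  ∀ (i : ℕ) (h : i + 1 < n), s ⟨i + 1, h⟩ = t ⟨i, Nat.lt_of_succ_lt h⟩

/-- Entries of `t` before the last are entries of `s`. For `n ≥ 2` the last one exceeds all of `s`;
for `n = 1` it differs because `s ≠ t`. -/
theorem IsShift.apply_eq_iff {n : ℕ} {s t : Fin n ↪o ℕ} (h : IsShift s t) (hne : s ≠ t)
    (p q : Fin n) : s p = t q ↔ (p : ℕ) = q + 1 := by
  obtain ⟨p, hp⟩ := p
  obtain ⟨q, hq⟩ := q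
  by_cases hq' : q + 1 < n
  · rw [← h q hq', s.injective.eq_iff, Fin.mk.injEq]
  · have hqn : q = n - 1 := by omega
    refine ⟨fun he => ?_, fun he => ?_⟩
    · exfalso
      rcases Nat.lt_or_ge 1 n with hn | hn
      · have h1 := h (n - 2) (by omega)
        have h2 : t ⟨n - 2, by omega⟩ < t ⟨q, hq⟩ := t.strictMono (Fin.mk_lt_mk.2 (by omega))
        have h3 : s ⟨p, hp⟩ ≤ s ⟨n - 2 + 1, by omega⟩ := s.monotone (Fin.mk_le_mk.2 (by omega))
        omega
      · apply hne
        ext ⟨x, hx⟩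
        have hx0 : x = p := by omega
        have hx1 : x = q := by omega
        subst hx0
        subst hx1
        exact he
    · simp only at he
      omega

namespace PatternCoding

variable {F : ℕ → ℕ → Prop} {m : ℕ} (c : PatternCoding F m) {n : ℕ}

open Classical in
/-- The index of the entry of an `n`-tuple that determines the `i`-th coordinate. -/
noncomputable def pos (hn : 0 < n) (i : ℕ) : Fin n :=
  if c.up (c.block i) then ⟨n - 1 - c.level i, by omega⟩ else ⟨min (c.level i) (n - 1), by omega⟩

open Classical in
/-- The `i`-th coordinate of the `m`-tuple assigned to an `n`-tuple `s`. -/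
noncomputable def val (hn : 0 < n) (i : ℕ) (s : Fin n ↪o ℕ) : ℕ ×ₗ ℤ ×ₗ ℚ :=
  -- A shift lowers the index of a common entry by one. Upward blocks therefore read the tuple from
  -- its end, and the minus sign restores the increasing order.
  toLex (c.block i, toLex (if F i i then 0 else
    if c.up (c.block i) then -(s (c.pos hn i) : ℤ) else s (c.pos hn i), c.offset i))

theorem pos_of_up (hn : 0 < n) {i : ℕ} (hu : c.up (c.block i)) :
    (c.pos hn i : ℕ) = n - 1 - c.level i := by
  rw [pos, if_pos hu]

theorem pos_of_not_up (hn : 0 < n) {i : ℕ} (hu : ¬ c.up (c.block i)) (hi : c.level i < n) :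
    (c.pos hn i : ℕ) = c.level i := by
  rw [pos, if_neg hu]
  exact min_eq_left (by omega)

theorem val_lt (hn : 0 < n) (hlev : ∀ i < m, ¬ F i i → c.level i < n) {i j : ℕ} (hij : i < j)
    (hj : j < m) (s : Fin n ↪o ℕ) : c.val hn i s < c.val hn j s := by
  rw [val, val, Prod.Lex.toLex_lt_toLex]
  rcases (c.block_mono hij.le).lt_or_eq with h | h
  · exact Or.inl h
  refine Or.inr ⟨h, ?_⟩
  have hi' : ¬ F i i := fun hf => hij.ne (c.eq_of_fixed hf h)
  have hj' : ¬ F j j := fun hf => hij.ne' (c.eq_of_fixed hf h.symm)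
  have hli := hlev i (hij.trans hj) hi'
  have hlj := hlev j hj hj'
  rw [Prod.Lex.toLex_lt_toLex]
  simp only [if_neg hi', if_neg hj']
  by_cases hu : c.up (c.block i)
  · have hpi := c.pos_of_up hn hu
    have hu' : c.up (c.block j) := h ▸ hu
    have hpj := c.pos_of_up hn hu'
    simp only [if_pos hu, if_pos hu', neg_lt_neg_iff, neg_inj, Nat.cast_lt, Nat.cast_inj, s.lt_iff_lt,
      s.injective.eq_iff, Fin.lt_def, Fin.ext_iff]
    rcases c.level_lt hij hj h with h1 | ⟨h1, h2⟩
    · exact Or.inl (by omega)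
    · exact Or.inr ⟨by omega, h2⟩
  · have hpi := c.pos_of_not_up hn hu hli
    have hu' : ¬ c.up (c.block j) := h ▸ hu
    have hpj := c.pos_of_not_up hn hu' hlj
    simp only [if_neg hu, if_neg hu', Nat.cast_lt, Nat.cast_inj, s.lt_iff_lt,
      s.injective.eq_iff, Fin.lt_def, Fin.ext_iff]
    rcases c.level_lt hij hj h with h1 | ⟨h1, h2⟩
    · exact Or.inl (by omega)
    · exact Or.inr ⟨by omega, h2⟩

/-- Equality of entries across a shift is a difference of one in index, hence in level. The last two
hypotheses are the instances of injectivity of `F` needed at fixed points. -/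
theorem val_eq_val_iff (hn : 0 < n) (hlev : ∀ i < m, ¬ F i i → c.level i < n) {i j : ℕ}
    (hi : i < m) (hj : j < m) {s t : Fin n ↪o ℕ} (hst : IsShift s t) (hne : s ≠ t)
    (hF : F i j → F j j → F i i) (hF' : F i i → F i j → i = j) :
    c.val hn i s = c.val hn j t ↔ F i j := by
  rw [val, val, EmbeddingLike.apply_eq_iff_eq, Prod.mk.injEq, EmbeddingLike.apply_eq_iff_eq,
    Prod.mk.injEq]
  by_cases hfi : F i i
  · constructor
    · rintro ⟨hb, -⟩
      obtain rfl := c.eq_of_fixed hfi hb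
      exact hfi
    · intro h
      obtain rfl := hF' hfi h
      simp [hfi]
  by_cases hfj : F j j
  · constructor
    · rintro ⟨hb, -⟩
      obtain rfl := c.eq_of_fixed hfj hb.symm
      exact hfj
    · exact fun h => absurd (hF h hfj) hfi
  have hli := hlev i hi hfi
  have hlj := hlev j hj hfj
  simp only [if_neg hfi, if_neg hfj]
  by_cases hu : c.up (c.block i)
  · rw [c.rel_up hi hj hfi hu]
    refine and_congr_right fun hb => ?_
    have hpi := c.pos_of_up hn hu
    have hu' : c.up (c.block j) := hb ▸ hu
    have hpj := c.pos_of_up hn hu'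
    simp only [if_pos hu, if_pos hu', neg_inj, Nat.cast_inj, hst.apply_eq_iff hne]
    exact and_congr (by omega) eq_comm
  · rw [c.rel_down hi hj hfi hu]
    refine and_congr_right fun hb => ?_
    have hpi := c.pos_of_not_up hn hu hli
    have hu' : ¬ c.up (c.block j) := hb ▸ hu
    have hpj := c.pos_of_not_up hn hu' hlj
    simp only [if_neg hu, if_neg hu', Nat.cast_inj, hst.apply_eq_iff hne]
    exact and_congr (by omega) eq_comm

/-- The block of a point of level `n - 1` contains every level from `0` to `n - 1`, so its
coordinates recover every entry. -/
theorem eq_of_val_eq (hn : 0 < n) {i : ℕ} (hi : i < m) (hfix : ¬ F i i)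
    (hlev : c.level i + 1 = n) {s t : Fin n ↪o ℕ}
    (h : ∀ j < m, c.val hn j s = c.val hn j t) : s = t := by
  ext p
  obtain ⟨j, hj, hb, hpos⟩ : ∃ j < m, c.block j = c.block i ∧ c.pos hn j = p := by
    by_cases hu : c.up (c.block i)
    · obtain ⟨j, hj, hb, hl⟩ := c.exists_level hi (n - 1 - p) (by omega)
      refine ⟨j, hj, hb, Fin.ext ?_⟩
      rw [c.pos_of_up hn (hb ▸ hu)]
      omega
    · obtain ⟨j, hj, hb, hl⟩ := c.exists_level hi p (by omega)
      refine ⟨j, hj, hb, Fin.ext ?_⟩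
      rw [c.pos_of_not_up hn (hb ▸ hu) (by omega), hl]
  have hfj : ¬ F j j := fun hf => hfix (c.eq_of_fixed hf hb ▸ hf)
  have hv := h j hj
  rw [val, val, EmbeddingLike.apply_eq_iff_eq, Prod.mk.injEq, EmbeddingLike.apply_eq_iff_eq,
    Prod.mk.injEq, if_neg hfj, if_neg hfj, hpos] at hv
  have := hv.2.1
  split_ifs at this <;> omega

end PatternCoding

/-! ### The theorem -/

/-- A graph without edges is properly coloured by a single colour. -/
theorem exists_adj_of_aleph0_le_cardChromaticNumber {V : Type u} (G : SimpleGraph V)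
    (h : Cardinal.aleph0 ≤ cardChromaticNumber G) : ∃ a b, G.Adj a b := by
  by_contra hne
  push Not at hne
  have h1 : cardChromaticNumber G ≤ 1 :=
    csInf_le' ⟨PUnit, Cardinal.mk_punit, ⟨SimpleGraph.Coloring.mk (fun _ => PUnit.unit)
      fun {a b} hab => absurd hab (hne a b)⟩⟩
  exact absurd (h.trans h1) (not_le.2 Cardinal.one_lt_aleph0)

/-- Finite parts of a linear order embed in every infinite linear order. -/
theorem exists_strictMonoOn_of_infinite {L A : Type*} [LinearOrder L] [LinearOrder A] [Infinite A]
    (T : Finset L) : ∃ e : L → A, StrictMonoOn e T := by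
  classical
  obtain ⟨U, hU⟩ := Infinite.exists_subset_card_eq A T.card
  refine ⟨fun x => if hx : x ∈ T then
    U.orderEmbOfFin hU ((T.orderIsoOfFin rfl).symm ⟨x, hx⟩) else Classical.arbitrary A, ?_⟩
  intro x hx z hz hxz
  simp only [Finset.mem_coe] at hx hz
  simpa [hx, hz] using hxz

theorem propositionP {A : Type u} [LinearOrder A] [Infinite A] (m : ℕ)
    (G : SimpleGraph (IncTuple m A))
    (hchi : Cardinal.aleph0 ≤ cardChromaticNumber G)
    (hpat : ∀ a b c d : IncTuple m A,
      G.Adj a b → eqPattern a b = eqPattern c d → G.Adj c d) :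
    ∃ n : ℕ, 1 ≤ n ∧ ContainsFiniteSubgraphs G (shiftGraph n ℕ) := by
  classical
  obtain ⟨a, b, hab⟩ := exists_adj_of_aleph0_le_cardChromaticNumber G hchi
  let F : ℕ → ℕ → Prop := fun i j => ∃ (hi : i < m) (hj : j < m), a ⟨i, hi⟩ = b ⟨j, hj⟩
  have hF : OrderPreservingRel F := by
    rintro i j i' j' ⟨hi, hj, h⟩ ⟨hi', hj', h'⟩
    have h1 : (⟨i, hi⟩ : Fin m) < ⟨i', hi'⟩ ↔ (⟨j, hj⟩ : Fin m) < ⟨j', hj'⟩ := by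
      rw [← a.lt_iff_lt, ← b.lt_iff_lt, h, h']
    simpa using h1
  obtain ⟨c⟩ := hF.nonempty_patternCoding m fun i j ⟨hi, hj, _⟩ => ⟨hi, hj⟩
  -- If every index were fixed, `a` and `b` would coincide.
  have hnonfix : ((Finset.range m).filter fun i => ¬ F i i).Nonempty := by
    by_contra hem
    rw [Finset.not_nonempty_iff_eq_empty, Finset.filter_eq_empty_iff] at hem
    refine hab.ne (RelEmbedding.ext fun i => ?_)
    obtain ⟨_, _, h⟩ := not_not.1 (hem (Finset.mem_range.2 i.2))
    exact h
  obtain ⟨i₀, hi₀, hmax⟩ := Finset.exists_max_image _ c.level hnonfix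
  simp only [Finset.mem_filter, Finset.mem_range, and_imp] at hi₀ hmax
  have hn : 0 < c.level i₀ + 1 := Nat.succ_pos _
  have hlev : ∀ i < m, ¬ F i i → c.level i < c.level i₀ + 1 := fun i hi hf =>
    Nat.lt_succ_of_le (hmax i hi hf)
  refine ⟨c.level i₀ + 1, hn, fun K hK => ?_⟩
  obtain ⟨e, he⟩ := exists_strictMonoOn_of_infinite (A := A)
    ((Finset.range m ×ˢ hK.toFinset).image fun p => c.val hn p.1 p.2)
  have hmem : ∀ (i : Fin m) (s : K.verts), c.val hn i s ∈
      (((Finset.range m ×ˢ hK.toFinset).image fun p => c.val hn p.1 p.2 : Finset _) : Set _) := by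
    intro i s
    exact Finset.mem_coe.2 (Finset.mem_image.2 ⟨(i, s), by simp, rfl⟩)
  let φ : K.verts → IncTuple m A := fun s => OrderEmbedding.ofStrictMono
    (fun i : Fin m => e (c.val hn i s))
    fun i j hij => he (hmem i s) (hmem j s) (c.val_lt hn hlev hij j.2 s)
  have hadj : ∀ s t : K.verts, s.1 ≠ t.1 → IsShift s.1 t.1 → G.Adj (φ s) (φ t) := by
    intro s t hne hst
    refine hpat a b _ _ hab (Set.ext fun p => ?_)
    change a p.1 = b p.2 ↔ e (c.val hn p.1 s) = e (c.val hn p.2 t)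
    rw [he.injOn.eq_iff (hmem _ _) (hmem _ _),
      c.val_eq_val_iff hn hlev p.1.2 p.2.2 hst hne]
    · exact ⟨fun h => ⟨p.1.2, p.2.2, h⟩, fun ⟨_, _, h⟩ => h⟩
    · intro h1 h2
      have h3 := hF h1 h2
      have h4 := hF h2 h1
      have h5 : (p.1 : ℕ) = p.2 := by omega
      rwa [h5]
    · intro h1 h2
      have h3 := hF h1 h2
      have h4 := hF h2 h1
      omega
  refine ⟨⟨⟨φ, ?_⟩, ?_⟩⟩
  · intro s t hst
    obtain ⟨hne, h | h⟩ := (SimpleGraph.fromRel_adj _ _ _).1 (K.adj_sub hst)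
    · exact hadj s t hne h
    · exact (hadj t s hne.symm h).symm
  · intro s t hst
    refine Subtype.ext (c.eq_of_val_eq hn hi₀.1 hi₀.2 rfl fun j hj => ?_)
    exact he.injOn (hmem ⟨j, hj⟩ s) (hmem ⟨j, hj⟩ t) (DFunLike.congr_fun hst ⟨j, hj⟩)
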